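/- Let $f:\mathbb{R}^n\to\mathbb{R}$ be $\mathcal{C}^2$ in a neighborhood of a nondegenerate critical point $\bar x$ of Morse index $1$ (that is, $\nabla f(\bar x)=0$, the Hessian of $f$ at $\bar x$ is invertible, and the maximal dimension of a subspace on which it is negative definite is $1$). For $\theta>0$ let $U=\{x : |x-\bar x|<\theta\}$, and consider the following algorithm with starting points $x_0,y_0\in U$. While $x_i\neq y_i$, given $x_i,y_i$: (1a) let $(\tilde x_i,\tilde y_i)$ be a minimizer of $|x-y|$ over all $x$ in the path component of $x_i$, and all $y$ in the path component of $y_i$, in $\{w\in U: f(w)\le f(x_i)\}$; replace $(x_i,y_i)$ by $(\tilde x_i,\tilde y_i)$; (1b) let $z_i$ be a minimizer of $f$ on $L_i\cap U$, where $L_i$ is the affine space orthogonal to $\tilde x_i-\tilde y_i$ passing through $\frac12(\tilde x_i+\tilde y_i)$; (2) let $x_{i+1}$ be the point of the segment $[\tilde x_i,z_i]$ furthest away from $\tilde x_i$ such that $f\le f(z_i)$ on the whole segment $[\tilde x_i,x_{i+1}]$, and let $y_{i+1}$ be the point obtained in the same way on $[\tilde y_i,z_i]$. If $x_i=y_i$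 is ever reached, the algorithm has terminated and the sequences are continued as constant ones ($\tilde x_i=\tilde y_i=z_i=x_{i+1}=y_{i+1}=x_i$). Then, for all sufficiently small $\theta>0$ the following holds. Let $x_0,y_0\in U$ be such that $f(x_0)=f(y_0)<f(\bar x)$ and such that $x_0$ and $y_0$ lie in different path components of $\{w\in U:f(w)\le f(x_0)\}$, and let $(x_i),(y_i),(\tilde x_i),(\tilde y_i),(z_i)$ be sequences generated by the algorithm from $x_0,y_0$. Then for all sufficiently large $i$, $x_{i+1}=z_i$ or $y_{i+1}=z_i$; moreover, if $x_i\ne y_i$ (the algorithm has not terminated), then along the broken line $\tilde x_i\to z_i\to\tilde y_i$ the function $f$ first strictly increases and then strictly decreases. -/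

import Mathlib

open Set Filter Topology

namespace MountainPass

/-- The Hessian of `f` at `x`, as a linear map sending `v` to the functional `H(x) v`. -/
noncomputable def hessian {n : ℕ} (f : EuclideanSpace ℝ (Fin n) → ℝ)
    (x : EuclideanSpace ℝ (Fin n)) :
    EuclideanSpace ℝ (Fin n) →L[ℝ] EuclideanSpace ℝ (Fin n) →L[ℝ] ℝ :=
  fderiv ℝ (fderiv ℝ f) x

/-- `k` is the Morse index of `f` at `x`: the maximum dimension of a subspace on which the
Hessian is negative definite. -/
def HasMorseIndex {n : ℕ} (f : EuclideanSpace ℝ (Fin n) → ℝ)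
    (x : EuclideanSpace ℝ (Fin n)) (k : ℕ) : Prop :=
  IsGreatest {d : ℕ | ∃ W : Submodule ℝ (EuclideanSpace ℝ (Fin n)),
    Module.finrank ℝ W = d ∧ ∀ v ∈ W, v ≠ 0 → hessian f x v v < 0} k

/-- `x` is a critical point of `f` at which the Hessian is invertible. -/
def IsNondegenerateCriticalPoint {n : ℕ} (f : EuclideanSpace ℝ (Fin n) → ℝ)
    (x : EuclideanSpace ℝ (Fin n)) : Prop :=
  fderiv ℝ f x = 0 ∧ Function.Bijective (hessian f x)

/-- The part of the lower level set `{w | f w ≤ c}` that lies in `U`. -/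
def levelSet {n : ℕ} (f : EuclideanSpace ℝ (Fin n) → ℝ) (U : Set (EuclideanSpace ℝ (Fin n)))
    (c : ℝ) : Set (EuclideanSpace ℝ (Fin n)) :=
  {w | f w ≤ c} ∩ U

/-- Step 1(a): `(xt, yt)` minimizes the distance `|u - v|` among all `u` in the path component
of `x`, and all `v` in the path component of `y`, in the level set of level `f x` within `U`. -/
def IsClosestPair {n : ℕ} (f : EuclideanSpace ℝ (Fin n) → ℝ)
    (U : Set (EuclideanSpace ℝ (Fin n))) (x y xt yt : EuclideanSpace ℝ (Fin n)) : Prop :=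
  JoinedIn (levelSet f U (f x)) x xt ∧ JoinedIn (levelSet f U (f x)) y yt ∧
    ∀ u v, JoinedIn (levelSet f U (f x)) x u → JoinedIn (levelSet f U (f x)) y v →
      dist xt yt ≤ dist u v

/-- Step 1(b): `z` minimizes `f` on `L ∩ U`, where `L` is the affine space orthogonal to
`xt - yt` through the midpoint of `xt` and `yt`. -/
def IsBisectorMin {n : ℕ} (f : EuclideanSpace ℝ (Fin n) → ℝ)
    (U : Set (EuclideanSpace ℝ (Fin n))) (xt yt z : EuclideanSpace ℝ (Fin n)) : Prop :=
  z ∈ (AffineSubspace.perpBisector xt yt : Set (EuclideanSpace ℝ (Fin n))) ∩ U ∧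
    IsMinOn f ((AffineSubspace.perpBisector xt yt : Set (EuclideanSpace ℝ (Fin n))) ∩ U) z

/-- Step 2: `x'` is the point furthest away from `a` on the segment `[a, z]` such that
`f ≤ f z` on the whole segment `[a, x']`. -/
def IsFurthestPoint {n : ℕ} (f : EuclideanSpace ℝ (Fin n) → ℝ)
    (a z x' : EuclideanSpace ℝ (Fin n)) : Prop :=
  (x' ∈ segment ℝ a z ∧ ∀ w ∈ segment ℝ a x', f w ≤ f z) ∧
    ∀ u ∈ segment ℝ a z, (∀ w ∈ segment ℝ a u, f w ≤ f z) → dist a u ≤ dist a x'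

/-- The sequences `x, y` (iterates), `xt, yt` (the points which replace them in step 1(a)) and
`z` (from step 1(b)) are generated by the fast local level set algorithm in the set `U`.
Steps 1 and 2 are repeated as long as `x i ≠ y i`; if `x i = y i` is ever reached, the algorithm
has terminated, and the sequences are continued as constant ones. -/
structure IsRun {n : ℕ} (f : EuclideanSpace ℝ (Fin n) → ℝ) (U : Set (EuclideanSpace ℝ (Fin n)))
    (x y xt yt z : ℕ → EuclideanSpace ℝ (Fin n)) : Prop where
  closest : ∀ i, x i ≠ y i → IsClosestPair f U (x i) (y i) (xt i) (yt i)
  bisector : ∀ i, x i ≠ y i → IsBisectorMin f U (xt i) (yt i) (z i)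
  next_x : ∀ i, x i ≠ y i → IsFurthestPoint f (xt i) (z i) (x (i + 1))
  next_y : ∀ i, x i ≠ y i → IsFurthestPoint f (yt i) (z i) (y (i + 1))
  stopped : ∀ i, x i = y i →
    xt i = x i ∧ yt i = x i ∧ z i = x i ∧ x (i + 1) = x i ∧ y (i + 1) = x i

/-- The broken line `a → z → b`, parametrized by `[0, 1]` with `z` at time `1 / 2`. -/
noncomputable def brokenLine {n : ℕ} (a z b : EuclideanSpace ℝ (Fin n)) (t : ℝ) :
    EuclideanSpace ℝ (Fin n) :=
  if t ≤ 1 / 2 then AffineMap.lineMap a z (2 * t) else AffineMap.lineMap z b (2 * t - 1)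

/-- `g` first (strictly) increases and then (strictly) decreases on `[0, 1]`. -/
def IncreasesThenDecreases (g : ℝ → ℝ) : Prop :=
  ∃ t ∈ Ioo (0 : ℝ) 1, StrictMonoOn g (Icc 0 t) ∧ StrictAntiOn g (Icc t 1)

end MountainPass

/-! On a small ball, `fderiv ℝ f p - fderiv ℝ f q` equals `H (p - q)` up to `ε * ‖p - q‖`, where the
Hessian `H` has one negative eigenvalue `-a`, with unit eigenvector `e`, and is at least `b` on the
complement of `e`.

Let `p, r` be a closest pair and `d = r - p`. Both points lie on the level `c`, and the gradients
there are multiples of `d` pointing towards each other (`isClosest_first_order`). Subtracting them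
shows that `d` is an approximate eigenvector of `H` for a nonpositive eigenvalue, so it is nearly
parallel to `e`, and `H` is positive on the complement of `d` (`of_approx_eigen`). Write `z = (p +
r) / 2 + u` with `u` orthogonal to `d`. The derivatives at `p` and `z` both kill `u`, which forces
`‖u‖ ≤ ‖d‖`; hence `H` is negative enough along `z - p` and `r - z` for `f` to be strictly concave
on both segments (`apply_lt`).

The derivatives at `z` along both segments are half the derivative along `d`. If that is
nonnegative, `f` increases on all of `[p, z]` and step 2 reaches `z` from `p`; otherwise it does so
from `r`. The argument concerns a single iteration, so it holds for every `i`. -/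

open scoped RealInnerProductSpace

namespace MountainPass

/-! ### Multipliers and strict concavity along segments -/

section Calculus

variable {E : Type*} [NormedAddCommGroup E] [InnerProductSpace ℝ E]

/-- A functional that can only be negative in directions `v` with `⟪d, v⟫ ≤ 0` is a nonnegative
multiple of `⟪d, ·⟫`. -/
lemma multiplier_rule {g : E →L[ℝ] ℝ} {d : E} (hd : d ≠ 0)
    (h : ∀ v, g v < 0 → ⟪d, v⟫ ≤ 0) :
    (∀ v, ⟪d, v⟫ = 0 → g v = 0) ∧ 0 ≤ g d := by
  have hdd : 0 < ⟪d, d⟫ := real_inner_self_pos.2 hd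
  have key : ∀ v, ⟪d, v⟫ = 0 → ¬ g v < 0 := by
    intro v hv hg
    have hpos : 0 < 1 + |g d| := by positivity
    -- Here `t * |g d| < -g v`, so pushing `v` by `t • d` keeps `g` negative but makes the inner
    -- product with `d` positive.
    set t : ℝ := -g v / (1 + |g d|) with ht
    have ht0 : 0 < t := div_pos (by linarith) hpos
    have h1 : g (v + t • d) < 0 := by
      have h2 : t * (1 + |g d|) = -g v := by rw [ht]; field_simp
      have h3 : t * g d ≤ t * |g d| := mul_le_mul_of_nonneg_left (le_abs_self _) ht0.le
      simp only [map_add, map_smul, smul_eq_mul]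
      nlinarith
    have h2 := h _ h1
    rw [inner_add_right, inner_smul_right, hv] at h2
    nlinarith [mul_pos ht0 hdd]
  refine ⟨fun v hv => ?_, ?_⟩
  · have h1 := key v hv
    have h2 := key (-v) (by simp [hv])
    simp only [map_neg] at h2
    linarith
  · by_contra hneg
    exact absurd (h d (not_le.1 hneg)) (not_le.2 hdd)

lemma eq_smul_inner_of_orthogonal {g : E →L[ℝ] ℝ} {d : E} (hd : d ≠ 0)
    (h : ∀ v, ⟪d, v⟫ = 0 → g v = 0) (v : E) : g v = g d / ⟪d, d⟫ * ⟪d, v⟫ := by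
  have hdd : ⟪d, d⟫ ≠ 0 := (real_inner_self_pos.2 hd).ne'
  have h1 := h (v - (⟪d, v⟫ / ⟪d, d⟫) • d) (by
    rw [inner_sub_right, inner_smul_right]; field_simp; ring)
  simp only [map_sub, map_smul, smul_eq_mul] at h1
  have h2 : g v = ⟪d, v⟫ / ⟪d, d⟫ * g d := by linarith
  rw [h2]; ring

/-- A function on `[0, 1]` with strictly decreasing derivative is unimodal. -/
lemma exists_unimodal {φ φ' : ℝ → ℝ} (hφ : ∀ t ∈ Icc (0 : ℝ) 1, HasDerivAt φ (φ' t) t)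
    (hanti : StrictAntiOn φ' (Icc 0 1)) (hcont : ContinuousOn φ' (Icc 0 1)) :
    ∃ s ∈ Icc (0 : ℝ) 1, StrictMonoOn φ (Icc 0 s) ∧ StrictAntiOn φ (Icc s 1) ∧
      (0 ≤ φ' 1 → s = 1) ∧ (φ' 0 ≤ 0 → s = 0) ∧ (0 < φ' 0 → 0 < s) ∧ (φ' 1 < 0 → s < 1) := by
  have h0 : (0 : ℝ) ∈ Icc (0 : ℝ) 1 := by simp
  have h1 : (1 : ℝ) ∈ Icc (0 : ℝ) 1 := by simp
  have h01 := hanti h0 h1 one_pos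
  have hc : ContinuousOn φ (Icc 0 1) := fun t ht => (hφ t ht).continuousAt.continuousWithinAt
  have hmono : ∀ s ∈ Icc (0 : ℝ) 1, 0 ≤ φ' s → StrictMonoOn φ (Icc 0 s) := by
    intro s hs hs0
    refine strictMonoOn_of_deriv_pos (convex_Icc 0 s) (hc.mono (Icc_subset_Icc le_rfl hs.2)) ?_
    intro t ht
    rw [interior_Icc] at ht
    have ht' : t ∈ Icc (0 : ℝ) 1 := ⟨ht.1.le, ht.2.le.trans hs.2⟩
    rw [(hφ t ht').deriv]
    exact hs0.trans_lt (hanti ht' hs ht.2)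
  have hdecr : ∀ s ∈ Icc (0 : ℝ) 1, φ' s ≤ 0 → StrictAntiOn φ (Icc s 1) := by
    intro s hs hs0
    refine strictAntiOn_of_deriv_neg (convex_Icc s 1) (hc.mono (Icc_subset_Icc hs.1 le_rfl)) ?_
    intro t ht
    rw [interior_Icc] at ht
    have ht' : t ∈ Icc (0 : ℝ) 1 := ⟨hs.1.trans ht.1.le, ht.2.le⟩
    rw [(hφ t ht').deriv]
    exact (hanti hs ht' ht.1).trans_le hs0
  rcases le_or_gt 0 (φ' 1) with h | h
  · refine ⟨1, h1, hmono 1 h1 h, by simp, fun _ => rfl, ?_, ?_, ?_⟩ <;> intros <;> linarith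
  rcases le_or_gt (φ' 0) 0 with h' | h'
  · refine ⟨0, h0, by simp, hdecr 0 h0 h', ?_, fun _ => rfl, ?_, ?_⟩ <;> intros <;> linarith
  obtain ⟨s, hs, hs0⟩ := intermediate_value_Icc' zero_le_one hcont ⟨h.le, h'.le⟩
  refine ⟨s, hs, hmono s hs hs0.ge, hdecr s hs hs0.le, ?_, ?_, ?_, ?_⟩
  · intros; linarith
  · intros; linarith
  · intro
    refine lt_of_le_of_ne hs.1 ?_
    rintro rfl
    linarith
  · intro
    refine lt_of_le_of_ne hs.2 ?_
    rintro rfl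
    linarith

/-- If the derivative of `f` is `ε`-close to `H` in the Lipschitz sense on a convex set, then `f` is
strictly concave along segments in directions in which `H` is sufficiently negative. -/
lemma exists_unimodal_segment {f : E → ℝ} {H : E →L[ℝ] E →L[ℝ] ℝ} {U : Set E} {ε : ℝ}
    (hU : Convex ℝ U) (hdiff : ∀ p ∈ U, DifferentiableAt ℝ f p)
    (happ : ∀ p ∈ U, ∀ q ∈ U, ‖fderiv ℝ f p - fderiv ℝ f q - H (p - q)‖ ≤ ε * ‖p - q‖)
    {p q : E} (hp : p ∈ U) (hq : q ∈ U) (hneg : H (q - p) (q - p) < -(ε * ‖q - p‖ ^ 2)) :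
    ∃ s ∈ Icc (0 : ℝ) 1,
      StrictMonoOn (fun t : ℝ => f (AffineMap.lineMap p q t)) (Icc 0 s) ∧
      StrictAntiOn (fun t : ℝ => f (AffineMap.lineMap p q t)) (Icc s 1) ∧
      (0 ≤ fderiv ℝ f q (q - p) → s = 1) ∧ (fderiv ℝ f p (q - p) ≤ 0 → s = 0) ∧
      (0 < fderiv ℝ f p (q - p) → 0 < s) ∧ (fderiv ℝ f q (q - p) < 0 → s < 1) := by
  have hmem : ∀ t ∈ Icc (0 : ℝ) 1, (AffineMap.lineMap p q t : E) ∈ U :=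
    fun t ht => hU.lineMap_mem hp hq ht
  have hdist : ∀ s t : ℝ, (AffineMap.lineMap p q t : E) - AffineMap.lineMap p q s
      = (t - s) • (q - p) := by
    intro s t
    simp only [AffineMap.lineMap_apply, vsub_eq_sub, vadd_eq_add]
    module
  have hderiv : ∀ t ∈ Icc (0 : ℝ) 1, HasDerivAt (fun t : ℝ => f (AffineMap.lineMap p q t))
      (fderiv ℝ f (AffineMap.lineMap p q t) (q - p)) t := fun t ht =>
    (hdiff _ (hmem t ht)).hasFDerivAt.comp_hasDerivAt t AffineMap.hasDerivAt_lineMap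
  -- The derivative along the segment is affine with slope `H (q - p) (q - p)`, up to an error with
  -- Lipschitz constant `ε * ‖q - p‖ ^ 2`; `hneg` makes the slope win.
  have hbound : ∀ s ∈ Icc (0 : ℝ) 1, ∀ t ∈ Icc (0 : ℝ) 1,
      |fderiv ℝ f (AffineMap.lineMap p q t) (q - p) - fderiv ℝ f (AffineMap.lineMap p q s) (q - p)
        - (t - s) * H (q - p) (q - p)| ≤ |t - s| * (ε * ‖q - p‖ ^ 2) := by
    intro s hs t ht
    have h1 := happ _ (hmem t ht) _ (hmem s hs)
    rw [hdist] at h1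
    have h2 := (ContinuousLinearMap.le_opNorm _ (q - p)).trans
      (mul_le_mul_of_nonneg_right h1 (norm_nonneg (q - p)))
    simp only [sub_apply, map_smul, smul_apply,
      smul_eq_mul, norm_smul, Real.norm_eq_abs] at h2
    refine h2.trans (le_of_eq (by ring))
  have hanti : StrictAntiOn (fun t : ℝ => fderiv ℝ f (AffineMap.lineMap p q t) (q - p))
      (Icc 0 1) := by
    intro s hs t ht hst
    have h1 := (abs_le.1 (hbound s hs t ht)).2
    rw [abs_of_pos (sub_pos.2 hst)] at h1
    have h2 := mul_lt_mul_of_pos_left hneg (sub_pos.2 hst)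
    show fderiv ℝ f (AffineMap.lineMap p q t) (q - p) <
      fderiv ℝ f (AffineMap.lineMap p q s) (q - p)
    linarith
  have hcont : ContinuousOn (fun t : ℝ => fderiv ℝ f (AffineMap.lineMap p q t) (q - p))
      (Icc 0 1) := by
    have hlip : ∀ s ∈ Icc (0 : ℝ) 1, ∀ t ∈ Icc (0 : ℝ) 1,
        dist (fderiv ℝ f (AffineMap.lineMap p q t) (q - p))
          (fderiv ℝ f (AffineMap.lineMap p q s) (q - p)) ≤
        (|ε * ‖q - p‖ ^ 2| + |H (q - p) (q - p)|) * dist t s := by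
      intro s hs t ht
      rw [Real.dist_eq, Real.dist_eq]
      have h1 := hbound s hs t ht
      have h2 := abs_sub_abs_le_abs_sub
        (fderiv ℝ f (AffineMap.lineMap p q t) (q - p)
          - fderiv ℝ f (AffineMap.lineMap p q s) (q - p)) ((t - s) * H (q - p) (q - p))
      rw [abs_mul (t - s)] at h2
      have h3 : |t - s| * (ε * ‖q - p‖ ^ 2) ≤ |t - s| * |ε * ‖q - p‖ ^ 2| :=
        mul_le_mul_of_nonneg_left (le_abs_self _) (abs_nonneg _)
      linarith
    exact (LipschitzOnWith.of_dist_le_mul (K := ⟨_, by positivity⟩)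
      fun t ht s hs => hlip s hs t ht).continuousOn
  have := exists_unimodal hderiv hanti hcont
  simpa only [AffineMap.lineMap_apply_zero, AffineMap.lineMap_apply_one] using this

end Calculus

/-! ### Stability estimates for saddle forms -/

section QuadraticForms

variable {E : Type*} [NormedAddCommGroup E] [InnerProductSpace ℝ E]

/-- `e` is a unit eigenvector of the bilinear form `H` for the eigenvalue `-a`, and `H` is at least
`b` on the orthogonal complement of `e`. -/
structure IsSaddleForm (H : E →L[ℝ] E →L[ℝ] ℝ) (e : E) (a b : ℝ) : Prop where
  symm : ∀ v w, H v w = H w v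
  norm_eq : ‖e‖ = 1
  a_pos : 0 < a
  b_pos : 0 < b
  eigen : ∀ v, H e v = -a * ⟪e, v⟫
  le_apply : ∀ v, ⟪e, v⟫ = 0 → b * ‖v‖ ^ 2 ≤ H v v

variable {H : E →L[ℝ] E →L[ℝ] ℝ} {e : E} {a b ε : ℝ}

lemma IsSaddleForm.apply_self_eq (hH : IsSaddleForm H e a b) (c : ℝ) {w : E} (hw : ⟪e, w⟫ = 0) :
    H (c • e + w) (c • e + w) = -a * c ^ 2 + H w w := by
  have h2 := hH.symm w e
  have h3 : ⟪e, e⟫ = 1 := by rw [real_inner_self_eq_norm_sq, hH.norm_eq]; norm_num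
  simp only [map_add, map_smul, add_apply, smul_apply,
    smul_eq_mul, h2, hH.eigen, hw, h3]
  ring

lemma IsSaddleForm.exists_decomp (hH : IsSaddleForm H e a b) (v : E) :
    ∃ c : ℝ, ∃ w : E, v = c • e + w ∧ ⟪e, w⟫ = 0 ∧ ‖v‖ ^ 2 = c ^ 2 + ‖w‖ ^ 2 := by
  have h3 : ⟪e, e⟫ = 1 := by rw [real_inner_self_eq_norm_sq, hH.norm_eq]; norm_num
  have hw : ⟪e, v - ⟪e, v⟫ • e⟫ = 0 := by rw [inner_sub_right, inner_smul_right, h3]; ring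
  refine ⟨⟪e, v⟫, v - ⟪e, v⟫ • e, by abel, hw, ?_⟩
  have h4 : v = ⟪e, v⟫ • e + (v - ⟪e, v⟫ • e) := by abel
  conv_lhs => rw [h4]
  rw [norm_add_sq_real, inner_smul_left, hw, norm_smul, hH.norm_eq, Real.norm_eq_abs, mul_one,
    sq_abs]
  simp

/-- An approximate eigenvector `d` for a nonpositive eigenvalue is nearly aligned with `e`. -/
lemma IsSaddleForm.of_approx_eigen (hH : IsSaddleForm H e a b) (hε : 0 < ε)
    (hεa : 48 * ε < a) (hεb : 4 * ε ≤ b) (hεab : 16 * a * ε ^ 2 ≤ b ^ 3)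
    {d : E} {η : ℝ} (hd : d ≠ 0) (hη : 0 ≤ η)
    (h : ∀ v, |H d v + η * ⟪d, v⟫| ≤ ε * ‖d‖ * ‖v‖) :
    H d d ≤ -(a / 2) * ‖d‖ ^ 2 ∧ ∀ v, ⟪d, v⟫ = 0 → b / 2 * ‖v‖ ^ 2 ≤ H v v := by
  have hapos := hH.a_pos
  have hbpos := hH.b_pos
  have hdpos : 0 < ‖d‖ := norm_pos_iff.2 hd
  obtain ⟨c, w, hdw, hw, hnorm⟩ := hH.exists_decomp d
  have hee : ⟪e, e⟫ = 1 := by rw [real_inner_self_eq_norm_sq, hH.norm_eq]; norm_num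
  have hwe : ⟪w, e⟫ = 0 := by rw [real_inner_comm, hw]
  -- Test `h` on `w`: the left side is `H w w + η * ‖w‖ ^ 2`, and `η ≥ 0` only helps.
  have hwsmall : b * ‖w‖ ≤ ε * ‖d‖ := by
    rcases (norm_nonneg w).eq_or_lt with h0 | h0
    · rw [← h0]; simp; positivity
    have h1 := (abs_le.1 (h w)).2
    have h2 : H d w = H w w := by
      rw [hdw]; simp [hH.eigen, hw]
    have h3 : ⟪d, w⟫ = ‖w‖ ^ 2 := by
      rw [hdw, inner_add_left, inner_smul_left, hw, real_inner_self_eq_norm_sq]; simp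
    rw [h2, h3] at h1
    have h4 := hH.le_apply w hw
    have h5 : 0 ≤ η * ‖w‖ ^ 2 := by positivity
    have h6 : (b * ‖w‖) * ‖w‖ ≤ (ε * ‖d‖) * ‖w‖ := by nlinarith
    exact le_of_mul_le_mul_right h6 h0
  have hw4 : 4 * ‖w‖ ≤ ‖d‖ := by
    have h1 : 4 * ε * ‖w‖ ≤ ε * ‖d‖ :=
      (mul_le_mul_of_nonneg_right hεb (norm_nonneg w)).trans hwsmall
    nlinarith
  have hc : ‖d‖ ^ 2 ≤ 4 * c ^ 2 := by nlinarith [norm_nonneg w]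
  have hcd : ‖d‖ ≤ 2 * |c| := by
    refine abs_le_of_sq_le_sq' (by rw [mul_pow, sq_abs]; linarith) (by positivity) |>.2
  have hcpos : 0 < |c| := by linarith
  refine ⟨?_, ?_⟩
  -- Testing on `e` gives `|η - a| ≤ 2 * ε`; testing on `d` then gives `H d d ≤ (3 * ε - a) * ‖d‖ ^
  -- 2`.
  · have h1 := h e
    have h2 : H d e + η * ⟪d, e⟫ = (η - a) * c := by
      rw [hH.symm, hH.eigen, ← real_inner_comm d e, hdw, inner_add_right, inner_smul_right, hee, hw]
      ring
    rw [h2, hH.norm_eq, abs_mul, mul_one] at h1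
    have h3 : |η - a| * |c| ≤ (2 * ε) * |c| := by nlinarith
    have h4 := (abs_le.1 (le_of_mul_le_mul_right h3 hcpos)).1
    have h5 := (abs_le.1 (h d)).2
    rw [real_inner_self_eq_norm_sq] at h5
    nlinarith [sq_nonneg ‖d‖]
  · intro v hv
    obtain ⟨s, v', hvv, hv', hvnorm⟩ := hH.exists_decomp v
    rw [hvnorm, hvv, hH.apply_self_eq s hv']
    -- Orthogonality to `d` bounds the `e`-component `s` of `v`, since `w` is small compared with
    -- `c`.
    have h1 : c * s + ⟪w, v'⟫ = 0 := by
      rw [hdw, hvv] at hv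
      simp only [inner_add_left, inner_add_right, inner_smul_left, inner_smul_right, hee, hwe,
        hv'] at hv
      simpa [mul_comm] using hv
    have h2 : |c| * |s| ≤ ‖w‖ * ‖v'‖ := by
      rw [← abs_mul, show c * s = -⟪w, v'⟫ by linarith, abs_neg]
      exact abs_real_inner_le_norm w v'
    have h3 : b * |s| ≤ 2 * ε * ‖v'‖ := by
      have h4 : b * |s| * |c| ≤ 2 * ε * ‖v'‖ * |c| := by
        calc b * |s| * |c| = b * (|c| * |s|) := by ring
          _ ≤ b * (‖w‖ * ‖v'‖) := by gcongr
          _ = b * ‖w‖ * ‖v'‖ := by ring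
          _ ≤ ε * ‖d‖ * ‖v'‖ := by gcongr
          _ ≤ ε * (2 * |c|) * ‖v'‖ := by gcongr
          _ = 2 * ε * ‖v'‖ * |c| := by ring
      exact le_of_mul_le_mul_right h4 hcpos
    have h5 : b ^ 2 * s ^ 2 ≤ 4 * ε ^ 2 * ‖v'‖ ^ 2 := by
      have := pow_le_pow_left₀ (by positivity) h3 2
      rw [mul_pow, sq_abs] at this
      linarith
    have h6 := hH.le_apply v' hv'
    have h7 : a * s ^ 2 ≤ b / 4 * ‖v'‖ ^ 2 := by
      have h8 : b ^ 2 * (a * s ^ 2) ≤ b ^ 2 * (b / 4 * ‖v'‖ ^ 2) := by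
        have h9 := mul_le_mul_of_nonneg_left h5 hapos.le
        have h10 := mul_le_mul_of_nonneg_right hεab (sq_nonneg ‖v'‖)
        linarith
      exact le_of_mul_le_mul_left h8 (by positivity)
    have h8 : b * s ^ 2 ≤ b / 4 * ‖v'‖ ^ 2 := by
      have h9 : b ^ 2 * s ^ 2 ≤ b ^ 2 * (‖v'‖ ^ 2 / 4) := by
        have h10 : 4 * ε ^ 2 ≤ b ^ 2 / 4 := by nlinarith
        have h11 := mul_le_mul_of_nonneg_right h10 (sq_nonneg ‖v'‖)
        linarith
      have h10 := le_of_mul_le_mul_left h9 (by positivity)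
      linarith [mul_le_mul_of_nonneg_left h10 hbpos.le]
    have h9 : 0 ≤ b * ‖v'‖ ^ 2 := by positivity
    linarith

/-- Combining `hu` with `hdu` bounds `H u u` by `ε * ‖d‖ * ‖u‖ + ε * ‖u‖ ^ 2`, while `huu` bounds it
below by `4 * ε * ‖u‖ ^ 2`; hence `‖u‖ ≤ ‖d‖`. Both values of `H` are then at most `(3 * ε - a / 8)
* ‖d‖ ^ 2`, and the right-hand sides are at least `-(9 / 4) * ε * ‖d‖ ^ 2`, so `48 * ε < a`
suffices. -/
lemma IsSaddleForm.apply_lt (hH : IsSaddleForm H e a b) (hε : 0 < ε)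
    (hεa : 48 * ε < a) (hεb : 8 * ε ≤ b) {d u : E} (hd : d ≠ 0)
    (hdd : H d d ≤ -(a / 2) * ‖d‖ ^ 2) (huu : b / 2 * ‖u‖ ^ 2 ≤ H u u)
    (hdu : |H d u| ≤ ε * ‖d‖ * ‖u‖)
    (hu : |H ((1 / 2 : ℝ) • d + u) u| ≤ ε * ‖(1 / 2 : ℝ) • d + u‖ * ‖u‖) :
    H ((1 / 2 : ℝ) • d + u) ((1 / 2 : ℝ) • d + u) < -(ε * ‖(1 / 2 : ℝ) • d + u‖ ^ 2) ∧
    H ((1 / 2 : ℝ) • d - u) ((1 / 2 : ℝ) • d - u) < -(ε * ‖(1 / 2 : ℝ) • d - u‖ ^ 2) := by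
  have hdpos : 0 < ‖d‖ := norm_pos_iff.2 hd
  have hn : ‖(1 / 2 : ℝ) • d‖ = ‖d‖ / 2 := by rw [norm_smul]; norm_num; ring
  have hn1 : ‖(1 / 2 : ℝ) • d + u‖ ≤ ‖d‖ / 2 + ‖u‖ := (norm_add_le _ _).trans_eq (by rw [hn])
  have hn2 : ‖(1 / 2 : ℝ) • d - u‖ ≤ ‖d‖ / 2 + ‖u‖ := (norm_sub_le _ _).trans_eq (by rw [hn])
  have hsymm := hH.symm u d
  have hHu : H u u ≤ ε * ‖d‖ * ‖u‖ + ε * ‖u‖ ^ 2 := by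
    have h1 := (abs_le.1 hu).2
    have h2 := (abs_le.1 hdu).1
    have h3 : ε * ‖(1 / 2 : ℝ) • d + u‖ * ‖u‖ ≤ ε * (‖d‖ / 2 + ‖u‖) * ‖u‖ := by gcongr
    simp only [map_add, map_smul, add_apply, smul_apply,
      smul_eq_mul] at h1
    nlinarith
  have hule : ‖u‖ ≤ ‖d‖ := by
    by_contra! hlt
    have h1 : 0 < ‖u‖ := hdpos.trans hlt
    have h2 : 4 * ε * ‖u‖ ^ 2 ≤ b / 2 * ‖u‖ ^ 2 := by gcongr; linarith
    have h3 : ε * ‖d‖ * ‖u‖ ≤ ε * ‖u‖ ^ 2 := by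
      rw [mul_assoc, sq]; gcongr
    nlinarith [mul_pos hε (pow_pos h1 2)]
  have h1 : ε * ‖d‖ * ‖u‖ ≤ ε * ‖d‖ ^ 2 := by rw [mul_assoc, sq]; gcongr
  have h2 : ε * ‖u‖ ^ 2 ≤ ε * ‖d‖ ^ 2 := by gcongr
  have h3 : 48 * ε * ‖d‖ ^ 2 < a * ‖d‖ ^ 2 := by gcongr
  have h4 : ε * ‖(1 / 2 : ℝ) • d + u‖ ^ 2 ≤ ε * (3 / 2 * ‖d‖) ^ 2 := by gcongr; linarith
  have h5 : ε * ‖(1 / 2 : ℝ) • d - u‖ ^ 2 ≤ ε * (3 / 2 * ‖d‖) ^ 2 := by gcongr; linarith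
  have h6 := abs_le.1 hdu
  simp only [map_add, map_sub, map_smul, add_apply,
    sub_apply, smul_apply, smul_eq_mul, hsymm]
  constructor <;> linarith

end QuadraticForms

/-! ### Saddle forms from Morse index one -/

section Spectral

variable {E : Type*} [NormedAddCommGroup E] [InnerProductSpace ℝ E] [FiniteDimensional ℝ E]

/-- A symmetric bilinear form is diagonal in some orthonormal basis. -/
lemma exists_diagonalization {H : E →L[ℝ] E →L[ℝ] ℝ} (hsymm : ∀ v w, H v w = H w v) :
    ∃ (B : OrthonormalBasis (Fin (Module.finrank ℝ E)) ℝ E) (l : Fin (Module.finrank ℝ E) → ℝ),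
      ∀ i v, H (B i) v = l i * ⟪B i, v⟫ := by
  let T : E →ₗ[ℝ] E :=
    { toFun := fun v => (InnerProductSpace.toDual ℝ E).symm (H v)
      map_add' := fun v w => by simp
      map_smul' := fun c v => by simp }
  have hT : ∀ v w, ⟪T v, w⟫ = H v w := fun v w => InnerProductSpace.toDual_symm_apply
  have hTs : T.IsSymmetric := fun v w => by
    rw [hT, real_inner_comm, hT, hsymm]
  refine ⟨hTs.eigenvectorBasis rfl, hTs.eigenvalues rfl, fun i v => ?_⟩
  rw [← hT, hTs.apply_eigenvectorBasis, inner_smul_left]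
  simp

/-- Injectivity excludes the eigenvalue zero, index at least one forces a negative eigenvalue, and
two of them would span a negative definite plane. -/
lemma exists_isSaddleForm {H : E →L[ℝ] E →L[ℝ] ℝ} (hsymm : ∀ v w, H v w = H w v)
    (hinj : Function.Injective H)
    (hindex : IsGreatest {d : ℕ | ∃ W : Submodule ℝ E,
      Module.finrank ℝ W = d ∧ ∀ v ∈ W, v ≠ 0 → H v v < 0} 1) :
    ∃ e a b, IsSaddleForm H e a b := by
  obtain ⟨B, l, hB⟩ := exists_diagonalization hsymm
  have hself : ∀ v, H v v = ∑ i, l i * ⟪B i, v⟫ ^ 2 := by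
    intro v
    have h1 : v = ∑ i, ⟪B i, v⟫ • B i := (B.sum_repr' v).symm
    have h2 : H v v = H (∑ i, ⟪B i, v⟫ • B i) v := by rw [← h1]
    rw [h2]
    simp only [map_sum, map_smul, sum_apply, smul_apply, smul_eq_mul, hB]
    exact Finset.sum_congr rfl fun i _ => by ring
  have hnorm : ∀ v, ‖v‖ ^ 2 = ∑ i, ⟪B i, v⟫ ^ 2 := by
    intro v
    rw [← B.sum_sq_norm_inner_right v]
    simp
  have hne : ∀ i, l i ≠ 0 := by
    intro i hi
    have h1 : H (B i) = H 0 := by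
      ext v; simp [hB, hi]
    exact B.orthonormal.ne_zero i (hinj h1)
  have hunit : ∀ i, ⟪B i, B i⟫ = 1 := fun i => by
    rw [real_inner_self_eq_norm_sq, B.orthonormal.1 i]; norm_num
  obtain ⟨i, hi⟩ : ∃ i, l i < 0 := by
    by_contra! hcon
    obtain ⟨W, hW, hneg⟩ := hindex.1
    have hWbot : W ≠ ⊥ := by
      rintro rfl
      simp at hW
    obtain ⟨v, hv, hv0⟩ := W.ne_bot_iff.1 hWbot
    have h1 := hneg v hv hv0
    rw [hself] at h1
    exact absurd h1 (not_lt.2 (Finset.sum_nonneg fun i _ => mul_nonneg (hcon i) (sq_nonneg _)))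
  have hpos : ∀ j, j ≠ i → 0 < l j := by
    intro j hji
    by_contra hj
    have hj : l j < 0 := lt_of_le_of_ne (not_lt.1 hj) (hne j)
    have hij : ⟪B i, B j⟫ = 0 := B.orthonormal.2 hji.symm
    have hji' : ⟪B j, B i⟫ = 0 := B.orthonormal.2 hji
    have hinj' : Function.Injective ![i, j] := by
      intro k m hkm
      fin_cases k <;> fin_cases m <;> simp_all
    have hli : LinearIndependent ℝ (B ∘ ![i, j]) := (B.orthonormal.comp _ hinj').linearIndependent
    have h2 : (2 : ℕ) ≤ 1 := hindex.2 ⟨Submodule.span ℝ (Set.range (B ∘ ![i, j])), by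
      rw [finrank_span_eq_card hli]; simp, by
      intro v hv hv0
      obtain ⟨c, rfl⟩ := (Submodule.mem_span_range_iff_exists_fun ℝ).1 hv
      have h3 : H (∑ k, c k • (B ∘ ![i, j]) k) (∑ k, c k • (B ∘ ![i, j]) k)
          = l i * c 0 ^ 2 + l j * c 1 ^ 2 := by
        simp only [Fin.sum_univ_two, Function.comp_apply, Matrix.cons_val_zero,
          Matrix.cons_val_one, map_add, map_smul, add_apply, smul_apply, smul_eq_mul, hB, hij, hji',
          hunit]
        ring
      rw [h3]
      by_cases h0 : c 0 = 0
      · by_cases h1 : c 1 = 0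
        · exact absurd (by simp [Fin.sum_univ_two, h0, h1]) hv0
        · have := mul_neg_of_neg_of_pos hj (by positivity : 0 < c 1 ^ 2)
          rw [h0]; linarith
      · have h4 := mul_neg_of_neg_of_pos hi (by positivity : 0 < c 0 ^ 2)
        have h5 := mul_nonpos_of_nonpos_of_nonneg hj.le (sq_nonneg (c 1))
        linarith⟩
    omega
  -- Taking any small `b`, rather than the minimum of the other `l j`, also covers dimension one.
  obtain ⟨b, hb, hbl⟩ : ∃ b > 0, ∀ j, j ≠ i → b ≤ l j := by
    have h1 : ∀ j ∈ (Finset.univ : Finset (Fin (Module.finrank ℝ E))),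
        ∀ᶠ b in 𝓝[>] (0 : ℝ), j ≠ i → b ≤ l j := by
      intro j _
      by_cases hj : j = i
      · exact Eventually.of_forall fun _ h => absurd hj h
      · filter_upwards [Ioo_mem_nhdsGT (hpos j hj)] with b hb _ using hb.2.le
    obtain ⟨b, hb, hb0⟩ := (((Filter.eventually_all_finset _).2 h1).and
      self_mem_nhdsWithin).exists
    exact ⟨b, hb0, fun j => hb j (Finset.mem_univ j)⟩
  refine ⟨B i, -l i, b, hsymm, B.orthonormal.1 i, by linarith, hb, fun v => by rw [hB]; ring, ?_⟩
  intro v hv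
  rw [hself, hnorm, Finset.mul_sum]
  refine Finset.sum_le_sum fun j _ => ?_
  by_cases hj : j = i
  · rw [hj, hv]; simp
  · exact mul_le_mul_of_nonneg_right (hbl j hj) (sq_nonneg _)

end Spectral

/-! ### First order conditions for steps 1(a) and 1(b) -/

section Minimizers

variable {E : Type*} [NormedAddCommGroup E] [InnerProductSpace ℝ E]

/-- Short segments from `p` in the direction `v` stay in the path component, so they cannot approach
`r`: `2 * t * ⟪r - p, v⟫ ≤ t ^ 2 * ‖v‖ ^ 2`. Divide by `t` and let `t` tend to zero. -/
lemma inner_nonpos_of_isClosest {S : Set E} {x p r v : E} (hp : JoinedIn S x p)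
    (hmin : ∀ u, JoinedIn S x u → dist p r ≤ dist u r)
    (hv : ∀ᶠ t in 𝓝[>] (0 : ℝ), p + t • v ∈ S) : ⟪r - p, v⟫ ≤ 0 := by
  obtain ⟨δ, hδ, hmem⟩ := (mem_nhdsGT_iff_exists_Ioo_subset (α := ℝ)).1 hv
  have hδ : 0 < δ := hδ
  have hdist : ∀ t ∈ Ioo 0 δ, 2 * ⟪r - p, v⟫ ≤ t * ‖v‖ ^ 2 := by
    intro t ht
    have hj : JoinedIn S p (p + t • v) := by
      refine JoinedIn.of_segment_subset ?_
      rw [segment_eq_image']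
      rintro _ ⟨s, hs, rfl⟩
      rcases hs.1.eq_or_lt with rfl | hs0
      · simpa using hp.target_mem
      · have : s * t ∈ Ioo 0 δ :=
          ⟨mul_pos hs0 ht.1, (mul_le_of_le_one_left ht.1.le hs.2).trans_lt ht.2⟩
        simpa [smul_smul] using hmem this
    have h1 := hmin _ (hp.trans hj)
    rw [dist_comm p, dist_comm _ r, dist_eq_norm, dist_eq_norm, sub_add_eq_sub_sub] at h1
    have h2 := pow_le_pow_left₀ (norm_nonneg _) h1 2
    rw [norm_sub_sq_real (r - p), inner_smul_right, norm_smul, Real.norm_eq_abs, mul_pow, sq_abs] at h2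
    have h3 : t * (2 * ⟪r - p, v⟫) ≤ t * (t * ‖v‖ ^ 2) := by linarith
    exact le_of_mul_le_mul_left h3 ht.1
  have hlim : Tendsto (fun t : ℝ => t * ‖v‖ ^ 2) (𝓝[>] 0) (𝓝 0) := by
    have : Continuous fun t : ℝ => t * ‖v‖ ^ 2 := by fun_prop
    simpa using this.continuousWithinAt (s := Ioi 0) (x := 0) |>.tendsto
  have := ge_of_tendsto hlim (Filter.mem_of_superset (Ioo_mem_nhdsGT hδ) hdist)
  linarith

/-- First order conditions for a point of a path component of a sublevel set which is closest
to a given point `r`. -/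
lemma isClosest_first_order {f : E → ℝ} {U : Set E} {c : ℝ} {x p r : E} (hU : IsOpen U)
    (hdiff : DifferentiableAt ℝ f p) (hp : JoinedIn ({w | f w ≤ c} ∩ U) x p)
    (hmin : ∀ u, JoinedIn ({w | f w ≤ c} ∩ U) x u → dist p r ≤ dist u r) (hpr : r - p ≠ 0) :
    f p = c ∧ (∀ v, ⟪r - p, v⟫ = 0 → fderiv ℝ f p v = 0) ∧ 0 ≤ fderiv ℝ f p (r - p) := by
  have hpS := hp.target_mem
  have hcurve : ∀ v : E, Tendsto (fun t : ℝ => p + t • v) (𝓝[>] 0) (𝓝 p) := by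
    intro v
    have : Continuous fun t : ℝ => p + t • v := by fun_prop
    simpa using this.continuousWithinAt (s := Ioi 0) (x := 0) |>.tendsto
  have hUv : ∀ v : E, ∀ᶠ t in 𝓝[>] (0 : ℝ), p + t • v ∈ U := fun v =>
    hcurve v (hU.mem_nhds hpS.2)
  refine ⟨le_antisymm hpS.1 ?_, multiplier_rule hpr fun v hv => ?_⟩
  -- Strictly below the level, moving straight towards `r` would be admissible.
  · by_contra! hlt
    have h1 := inner_nonpos_of_isClosest hp hmin (v := r - p) (by
      filter_upwards [hUv (r - p),
        (hdiff.continuousAt.tendsto.comp (hcurve (r - p))).eventually_lt_const hlt] with t ht ht'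
      exact ⟨ht'.le, ht⟩)
    exact absurd h1 (not_le.2 (real_inner_self_pos.2 hpr))
  · refine inner_nonpos_of_isClosest hp hmin ?_
    have hline : HasDerivAt (fun t : ℝ => p + t • v) v 0 := by
      simpa using ((hasDerivAt_id (0 : ℝ)).smul_const v).const_add p
    have hd : HasDerivAt (fun t : ℝ => f (p + t • v)) (fderiv ℝ f p v) 0 := by
      refine HasFDerivAt.comp_hasDerivAt (0 : ℝ) ?_ hline
      simpa using hdiff.hasFDerivAt
    have hslope := (hasDerivWithinAt_iff_tendsto_slope' (s := Ioi 0) (by simp)).1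
      hd.hasDerivWithinAt
    filter_upwards [hUv v, hslope.eventually_lt_const hv, self_mem_nhdsWithin] with t ht ht' ht0
    have ht0 : 0 < t := ht0
    refine ⟨?_, ht⟩
    rw [slope_def_field, sub_zero, div_lt_iff₀ ht0] at ht'
    have := hpS.1
    simp only [zero_smul, add_zero, zero_mul, mem_ofPred_eq] at ht' this ⊢
    linarith

/-- The line through `z` in the direction `v` stays in the bisector, so `f` has a local minimum at
`z` along it. -/
lemma fderiv_eq_zero_of_isMinOn_perpBisector {f : E → ℝ} {U : Set E} {p r z v : E}
    (hU : IsOpen U) (hdiff : DifferentiableAt ℝ f z)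
    (hz : z ∈ (AffineSubspace.perpBisector p r : Set E) ∩ U)
    (hmin : IsMinOn f ((AffineSubspace.perpBisector p r : Set E) ∩ U) z)
    (hv : ⟪r - p, v⟫ = 0) : fderiv ℝ f z v = 0 := by
  have hcurve : Tendsto (fun t : ℝ => z + t • v) (𝓝 0) (𝓝 z) := by
    have : Continuous fun t : ℝ => z + t • v := by fun_prop
    simpa using this.tendsto 0
  have hline : HasDerivAt (fun t : ℝ => z + t • v) v 0 := by
    simpa using ((hasDerivAt_id (0 : ℝ)).smul_const v).const_add z
  have hd : HasDerivAt (fun t : ℝ => f (z + t • v)) (fderiv ℝ f z v) 0 := by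
    refine HasFDerivAt.comp_hasDerivAt (0 : ℝ) ?_ hline
    simpa using hdiff.hasFDerivAt
  refine IsLocalMin.hasDerivAt_eq_zero ?_ hd
  filter_upwards [hcurve (hU.mem_nhds hz.2)] with t ht
  have h1 := AffineSubspace.mem_perpBisector_iff_inner_eq_zero'.1 hz.1
  have h2 : z + t • v ∈ AffineSubspace.perpBisector p r := by
    rw [AffineSubspace.mem_perpBisector_iff_inner_eq_zero']
    simp only [vsub_eq_sub] at h1 ⊢
    rw [add_sub_right_comm, inner_add_right, h1, inner_smul_right, hv]
    simp
  simpa using hmin ⟨h2, ht⟩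

end Minimizers

/-! ### Gluing unimodal functions; reaching `z` in step 2 -/

section BrokenLine

variable {n : ℕ} {f : EuclideanSpace ℝ (Fin n) → ℝ} {a z b : EuclideanSpace ℝ (Fin n)}

lemma brokenLine_of_le {t : ℝ} (ht : t ≤ 1 / 2) :
    brokenLine a z b t = AffineMap.lineMap a z (2 * t) := if_pos ht

lemma brokenLine_of_ge {t : ℝ} (ht : 1 / 2 ≤ t) :
    brokenLine a z b t = AffineMap.lineMap z b (2 * t - 1) := by
  rcases ht.eq_or_lt with rfl | h
  · rw [brokenLine_of_le le_rfl]; norm_num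
  · exact if_neg (not_le.2 h)

/-- If the first piece only increases, the peak is that of the second, at time `(1 + s₂) / 2`; if
the second only decreases, it is at `s₁ / 2`. The strict inequalities in `h` keep the peak inside
`(0, 1)`. -/
lemma increasesThenDecreases_brokenLine {s₁ s₂ : ℝ} (hs₁ : s₁ ∈ Icc (0 : ℝ) 1)
    (hs₂ : s₂ ∈ Icc (0 : ℝ) 1)
    (hm₁ : StrictMonoOn (fun t : ℝ => f (AffineMap.lineMap a z t)) (Icc 0 s₁))
    (ha₁ : StrictAntiOn (fun t : ℝ => f (AffineMap.lineMap a z t)) (Icc s₁ 1))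
    (hm₂ : StrictMonoOn (fun t : ℝ => f (AffineMap.lineMap z b t)) (Icc 0 s₂))
    (ha₂ : StrictAntiOn (fun t : ℝ => f (AffineMap.lineMap z b t)) (Icc s₂ 1))
    (h : (s₁ = 1 ∧ s₂ < 1) ∨ (s₂ = 0 ∧ 0 < s₁)) :
    IncreasesThenDecreases (fun t => f (brokenLine a z b t)) := by
  obtain ⟨h10, h11⟩ := hs₁
  obtain ⟨h20, h21⟩ := hs₂
  have hM₁ : StrictMonoOn (fun t => f (brokenLine a z b t)) (Icc 0 (s₁ / 2)) := by
    rintro t ⟨ht0, ht1⟩ t' ⟨ht0', ht1'⟩ htt'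
    show f (brokenLine a z b t) < f (brokenLine a z b t')
    rw [brokenLine_of_le (by linarith), brokenLine_of_le (by linarith)]
    exact hm₁ ⟨by linarith, by linarith⟩ ⟨by linarith, by linarith⟩ (by linarith)
  have hA₁ : StrictAntiOn (fun t => f (brokenLine a z b t)) (Icc (s₁ / 2) (1 / 2)) := by
    rintro t ⟨ht0, ht1⟩ t' ⟨ht0', ht1'⟩ htt'
    show f (brokenLine a z b t') < f (brokenLine a z b t)
    rw [brokenLine_of_le (by linarith), brokenLine_of_le (by linarith)]
    exact ha₁ ⟨by linarith, by linarith⟩ ⟨by linarith, by linarith⟩ (by linarith)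
  have hM₂ : StrictMonoOn (fun t => f (brokenLine a z b t)) (Icc (1 / 2) ((1 + s₂) / 2)) := by
    rintro t ⟨ht0, ht1⟩ t' ⟨ht0', ht1'⟩ htt'
    show f (brokenLine a z b t) < f (brokenLine a z b t')
    rw [brokenLine_of_ge (by linarith), brokenLine_of_ge (by linarith)]
    exact hm₂ ⟨by linarith, by linarith⟩ ⟨by linarith, by linarith⟩ (by linarith)
  have hA₂ : StrictAntiOn (fun t => f (brokenLine a z b t)) (Icc ((1 + s₂) / 2) 1) := by
    rintro t ⟨ht0, ht1⟩ t' ⟨ht0', ht1'⟩ htt'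
    show f (brokenLine a z b t') < f (brokenLine a z b t)
    rw [brokenLine_of_ge (by linarith), brokenLine_of_ge (by linarith)]
    exact ha₂ ⟨by linarith, by linarith⟩ ⟨by linarith, by linarith⟩ (by linarith)
  rcases h with ⟨rfl, h⟩ | ⟨rfl, h⟩
  · refine ⟨(1 + s₂) / 2, ⟨by linarith, by linarith⟩, ?_, hA₂⟩
    rw [← Icc_union_Icc_eq_Icc (by norm_num : (0 : ℝ) ≤ 1 / 2) (by linarith)]
    exact hM₁.union hM₂ (isGreatest_Icc (by norm_num)) (isLeast_Icc (by linarith))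
  · refine ⟨s₁ / 2, ⟨by linarith, by linarith⟩, hM₁, ?_⟩
    rw [← Icc_union_Icc_eq_Icc (by linarith : s₁ / 2 ≤ 1 / 2) (by norm_num)]
    rw [add_zero] at hA₂
    exact hA₁.union hA₂ (isGreatest_Icc (by linarith)) (isLeast_Icc (by norm_num))

/-- If `f` increases along `[a, z]`, then step 2 of the algorithm reaches `z`. -/
lemma IsFurthestPoint.eq_of_strictMonoOn {x' : EuclideanSpace ℝ (Fin n)}
    (hx' : IsFurthestPoint f a z x')
    (hmono : StrictMonoOn (fun t : ℝ => f (AffineMap.lineMap a z t)) (Icc 0 1)) : x' = z := by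
  have hle : ∀ w ∈ segment ℝ a z, f w ≤ f z := by
    intro w hw
    rw [segment_eq_image_lineMap] at hw
    obtain ⟨t, ht, rfl⟩ := hw
    simpa using hmono.monotoneOn ht (right_mem_Icc.2 zero_le_one) ht.2
  have h1 := hx'.2 z (right_mem_segment ℝ a z) hle
  have h2 := dist_add_dist_of_mem_segment hx'.1.1
  exact dist_le_zero.1 (by linarith)

end BrokenLine

/-! ### One iteration near the saddle -/

section Step

variable {E : Type*} [NormedAddCommGroup E] [InnerProductSpace ℝ E]

/-- Close to a saddle point, if `f p = f r` and the derivatives of `f` at `p` and `r` are multiples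
of `⟪r - p, ·⟫` (as for closest points of two components of a sublevel set), and if the derivative
at a point `z` of the perpendicular bisector vanishes along it, then `f` is unimodal on `[p, z]` and
`[z, r]`, and it is monotone on one of them. -/
lemma IsSaddleForm.exists_unimodal_of_critical {f : E → ℝ} {H : E →L[ℝ] E →L[ℝ] ℝ} {e : E}
    {a b ε : ℝ} (hH : IsSaddleForm H e a b) (hε : 0 < ε) (hεa : 48 * ε < a) (hεb : 8 * ε ≤ b)
    (hεab : 16 * a * ε ^ 2 ≤ b ^ 3) {U : Set E} (hU : Convex ℝ U)
    (hdiff : ∀ p ∈ U, DifferentiableAt ℝ f p)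
    (happ : ∀ p ∈ U, ∀ q ∈ U, ‖fderiv ℝ f p - fderiv ℝ f q - H (p - q)‖ ≤ ε * ‖p - q‖)
    {p r z : E} (hp : p ∈ U) (hr : r ∈ U) (hz : z ∈ U) (hpr : r - p ≠ 0) (hfpr : f p = f r)
    (hp₀ : ∀ v, ⟪r - p, v⟫ = 0 → fderiv ℝ f p v = 0) (hp₁ : 0 ≤ fderiv ℝ f p (r - p))
    (hr₀ : ∀ v, ⟪r - p, v⟫ = 0 → fderiv ℝ f r v = 0) (hr₁ : fderiv ℝ f r (r - p) ≤ 0)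
    (hz₀ : ∀ v, ⟪r - p, v⟫ = 0 → fderiv ℝ f z v = 0)
    (hzpr : z ∈ AffineSubspace.perpBisector p r) :
    ∃ s₁ ∈ Icc (0 : ℝ) 1, ∃ s₂ ∈ Icc (0 : ℝ) 1,
      StrictMonoOn (fun t : ℝ => f (AffineMap.lineMap p z t)) (Icc 0 s₁) ∧
      StrictAntiOn (fun t : ℝ => f (AffineMap.lineMap p z t)) (Icc s₁ 1) ∧
      StrictMonoOn (fun t : ℝ => f (AffineMap.lineMap z r t)) (Icc 0 s₂) ∧
      StrictAntiOn (fun t : ℝ => f (AffineMap.lineMap z r t)) (Icc s₂ 1) ∧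
      ((s₁ = 1 ∧ s₂ < 1) ∨ (s₂ = 0 ∧ 0 < s₁)) := by
  have happ' : ∀ p ∈ U, ∀ q ∈ U, ∀ v,
      |fderiv ℝ f p v - fderiv ℝ f q v - H (p - q) v| ≤ ε * ‖p - q‖ * ‖v‖ := fun p hp q hq v =>
    (ContinuousLinearMap.le_opNorm (fderiv ℝ f p - fderiv ℝ f q - H (p - q)) v).trans
      (mul_le_mul_of_nonneg_right (happ p hp q hq) (norm_nonneg v))
  obtain ⟨d, hd⟩ : ∃ d, d = r - p := ⟨_, rfl⟩
  rw [← hd] at hpr hp₀ hp₁ hr₀ hr₁ hz₀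
  have hdd : 0 < ⟪d, d⟫ := real_inner_self_pos.2 hpr
  have hdnorm : 0 < ‖d‖ := norm_pos_iff.2 hpr
  -- `d` is an approximate eigenvector of `H`
  have halign := hH.of_approx_eigen hε hεa (by linarith) hεab hpr
    -- The derivative at `r` minus that at `p` is exactly `-η * ⟪d, ·⟫`, and it is close to `H d`.
    (η := (fderiv ℝ f p d - fderiv ℝ f r d) / ⟪d, d⟫)
    (div_nonneg (by linarith) hdd.le) (fun v => by
      have h1 := happ' r hr p hp v
      rw [← hd, eq_smul_inner_of_orthogonal hpr hp₀ v,
        eq_smul_inner_of_orthogonal hpr hr₀ v] at h1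
      rw [← abs_neg]
      refine le_of_eq_of_le (congrArg _ ?_) h1
      ring)
  obtain ⟨hddneg, hconv⟩ := halign
  have hdneg : H d d < -(ε * ‖d‖ ^ 2) := by
    have : ε * ‖d‖ ^ 2 < a / 2 * ‖d‖ ^ 2 := by gcongr; linarith
    linarith
  -- the derivatives at `p` and `r` do not vanish
  obtain ⟨s, hs, hs1, hs2, hs3, hs4, hs5, hs6⟩ :=
    exists_unimodal_segment hU hdiff happ hp hr (by rw [← hd]; exact hdneg)
  rw [← hd] at hs3 hs4
  -- Otherwise strict concavity would make `f` strictly monotone on `[p, r]`, against `f p = f r`.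
  have hp₂ : 0 < fderiv ℝ f p d := by
    by_contra! hcon
    have h0 := hs4 hcon
    rw [h0] at hs2
    have := hs2 (left_mem_Icc.2 zero_le_one) (right_mem_Icc.2 zero_le_one) one_pos
    simp [hfpr] at this
  have hr₂ : fderiv ℝ f r d < 0 := by
    by_contra! hcon
    have h0 := hs3 hcon
    rw [h0] at hs1
    have := hs1 (left_mem_Icc.2 zero_le_one) (right_mem_Icc.2 zero_le_one) one_pos
    simp [hfpr] at this
  -- the position of `z`
  obtain ⟨u, hu⟩ : ∃ u, u = z - midpoint ℝ p r := ⟨_, rfl⟩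
  have hdu : ⟪d, u⟫ = 0 := by
    have := AffineSubspace.mem_perpBisector_iff_inner_eq_zero'.1 hzpr
    rwa [vsub_eq_sub, vsub_eq_sub, ← hu, ← hd] at this
  have hzp : z - p = (1 / 2 : ℝ) • d + u := by
    rw [hu, hd, midpoint_eq_smul_add, invOf_eq_inv]; module
  have hrz : r - z = (1 / 2 : ℝ) • d - u := by
    rw [hu, hd, midpoint_eq_smul_add, invOf_eq_inv]; module
  have hHdu : |H d u| ≤ ε * ‖d‖ * ‖u‖ := by
    have h1 := happ' r hr p hp u
    rwa [← hd, hp₀ u hdu, hr₀ u hdu, sub_zero, zero_sub, abs_neg] at h1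
  have hHu : |H ((1 / 2 : ℝ) • d + u) u| ≤ ε * ‖(1 / 2 : ℝ) • d + u‖ * ‖u‖ := by
    have h1 := happ' z hz p hp u
    rwa [hzp, hp₀ u hdu, hz₀ u hdu, sub_zero, zero_sub, abs_neg] at h1
  obtain ⟨hneg₁, hneg₂⟩ := hH.apply_lt hε hεa hεb hpr hddneg (hconv u hdu) hHdu hHu
  rw [← hzp] at hneg₁
  rw [← hrz] at hneg₂
  obtain ⟨s₁, hs₁, hm₁, ha₁, hz1, -, hp3, -⟩ :=
    exists_unimodal_segment hU hdiff happ hp hz hneg₁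
  obtain ⟨s₂, hs₂, hm₂, ha₂, -, hz2, -, hr3⟩ :=
    exists_unimodal_segment hU hdiff happ hz hr hneg₂
  -- The derivatives at `p`, `z` and `r` kill `u`, so only the component `d / 2` contributes.
  simp only [hzp, map_add, map_smul, smul_eq_mul, hp₀ u hdu, hz₀ u hdu] at hz1 hp3
  simp only [hrz, map_sub, map_smul, smul_eq_mul, hr₀ u hdu, hz₀ u hdu] at hz2 hr3
  refine ⟨s₁, hs₁, s₂, hs₂, hm₁, ha₁, hm₂, ha₂, ?_⟩
  rcases le_total 0 (fderiv ℝ f z d) with h | h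
  · exact Or.inl ⟨hz1 (by linarith), hr3 (by linarith)⟩
  · exact Or.inr ⟨hz2 (by linarith), hp3 (by linarith)⟩

/-- Close to a saddle point, `f` has no minimizer on an open convex set. -/
lemma IsSaddleForm.not_isMinOn {f : E → ℝ} {H : E →L[ℝ] E →L[ℝ] ℝ} {e : E}
    {a b ε : ℝ} (hH : IsSaddleForm H e a b) (hεa : ε < a) {U : Set E} (hU : Convex ℝ U)
    (hUo : IsOpen U) (hdiff : ∀ p ∈ U, DifferentiableAt ℝ f p)
    (happ : ∀ p ∈ U, ∀ q ∈ U, ‖fderiv ℝ f p - fderiv ℝ f q - H (p - q)‖ ≤ ε * ‖p - q‖)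
    {z : E} (hz : z ∈ U) : ¬ IsMinOn f U z := by
  intro hmin
  have hzero : fderiv ℝ f z = 0 := (hmin.isLocalMin (hUo.mem_nhds hz)).fderiv_eq_zero
  have hcurve : Tendsto (fun t : ℝ => z + t • e) (𝓝[>] 0) (𝓝 z) := by
    have : Continuous fun t : ℝ => z + t • e := by fun_prop
    simpa using this.continuousWithinAt (s := Ioi 0) (x := 0) |>.tendsto
  obtain ⟨t, ht, ht0⟩ := ((hcurve.eventually (hUo.eventually_mem hz)).and self_mem_nhdsWithin).exists
  have ht0 : 0 < t := ht0
  have hee : ⟪e, e⟫ = 1 := by rw [real_inner_self_eq_norm_sq, hH.norm_eq]; norm_num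
  -- A minimizer would be critical, and strict concavity along `e` makes `f` drop from there.
  obtain ⟨s, -, -, hanti, -, hs, -, -⟩ := exists_unimodal_segment hU hdiff happ hz ht (by
    rw [add_sub_cancel_left, norm_smul, hH.norm_eq, Real.norm_eq_abs, mul_one, sq_abs]
    simp only [map_smul, smul_apply, smul_eq_mul, hH.eigen, hee]
    nlinarith [mul_pos ht0 ht0])
  have hs0 : s = 0 := hs (by simp [hzero])
  rw [hs0] at hanti
  have h1 := hanti (left_mem_Icc.2 zero_le_one) (right_mem_Icc.2 zero_le_one) one_pos
  simp only [AffineMap.lineMap_apply_zero, AffineMap.lineMap_apply_one] at h1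
  exact absurd (hmin ht) (not_le.2 h1)

end Step

/-- On small balls around a nondegenerate critical point of Morse index one, the derivative of `f` is
uniformly close to a linear map given by a saddle form. -/
lemma exists_isSaddleForm_approx {n : ℕ} {f : EuclideanSpace ℝ (Fin n) → ℝ}
    {xbar : EuclideanSpace ℝ (Fin n)} (hf : ContDiffAt ℝ 2 f xbar)
    (hcrit : IsNondegenerateCriticalPoint f xbar) (hmorse : HasMorseIndex f xbar 1) :
    ∃ e a b ε θ₀, IsSaddleForm (hessian f xbar) e a b ∧ 0 < ε ∧ 48 * ε < a ∧ 8 * ε ≤ b ∧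
      16 * a * ε ^ 2 ≤ b ^ 3 ∧ 0 < θ₀ ∧
      (∀ p ∈ Metric.ball xbar θ₀, DifferentiableAt ℝ f p) ∧
      ∀ p ∈ Metric.ball xbar θ₀, ∀ q ∈ Metric.ball xbar θ₀,
        ‖fderiv ℝ f p - fderiv ℝ f q - hessian f xbar (p - q)‖ ≤ ε * ‖p - q‖ := by
  have hsymm : ∀ v w, hessian f xbar v w = hessian f xbar w v := fun v w =>
    hf.isSymmSndFDerivAt (by simp) v w
  obtain ⟨e, a, b, hH⟩ := exists_isSaddleForm hsymm hcrit.2.1 hmorse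
  have ha := hH.a_pos
  have hb := hH.b_pos
  obtain ⟨ε, ⟨h1, h2, h3⟩, hε⟩ : ∃ ε : ℝ, (48 * ε < a ∧ 8 * ε < b ∧ 16 * a * ε ^ 2 < b ^ 3) ∧
      ε ∈ Ioi (0 : ℝ) := by
    have hlim : ∀ {g : ℝ → ℝ} {c : ℝ}, Continuous g → g 0 < c → ∀ᶠ t in 𝓝[>] (0 : ℝ), g t < c :=
      fun hg hc => (hg.continuousWithinAt (s := Ioi 0) (x := 0)).tendsto.eventually_lt_const hc
    exact ((((hlim (by fun_prop) (by simpa using ha)).and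
      ((hlim (by fun_prop) (by simpa using hb)).and
        (hlim (by fun_prop) (by simp; positivity))))).and self_mem_nhdsWithin).exists
  have hε : 0 < ε := hε
  -- Strict differentiability of the derivative is what provides the estimate for pairs `p`, `q`.
  have hstrict : HasStrictFDerivAt (fderiv ℝ f) (hessian f xbar) xbar :=
    (hf.fderiv_right (m := 1) (by norm_num)).hasStrictFDerivAt (by norm_num)
  have hev := hstrict.isLittleO.def hε
  rw [nhds_prod_eq] at hev
  obtain ⟨S, hS, hSapp⟩ := eventually_prod_self_iff'.1 hev
  have hdiff : ∀ᶠ p in 𝓝 xbar, DifferentiableAt ℝ f p :=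
    (hf.eventually (by norm_num)).mono fun p hp => hp.differentiableAt (by norm_num)
  obtain ⟨θ₀, hθ₀, hball⟩ := Metric.eventually_nhds_iff_ball.1
    (hdiff.and (Filter.eventually_mem_set.2 hS))
  exact ⟨e, a, b, ε, θ₀, hH, hε, h1, h2.le, h3.le, hθ₀, fun p hp => (hball p hp).1,
    fun p hp q hq => hSapp p (hball p hp).2 q (hball q hq).2⟩

end MountainPass

theorem mainTheorem7 {n : ℕ} (f : EuclideanSpace ℝ (Fin n) → ℝ)
    (xbar : EuclideanSpace ℝ (Fin n))
    (hf : ContDiffAt ℝ 2 f xbar)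
    (hcrit : MountainPass.IsNondegenerateCriticalPoint f xbar)
    (hmorse : MountainPass.HasMorseIndex f xbar 1) :
    ∃ θ₀ > (0 : ℝ), ∀ θ : ℝ, 0 < θ → θ < θ₀ →
      ∀ x y xt yt z : ℕ → EuclideanSpace ℝ (Fin n),
        x 0 ∈ Metric.ball xbar θ →
        y 0 ∈ Metric.ball xbar θ →
        f (x 0) = f (y 0) →
        f (x 0) < f xbar →
        ¬ JoinedIn (MountainPass.levelSet f (Metric.ball xbar θ) (f (x 0))) (x 0) (y 0) →
        MountainPass.IsRun f (Metric.ball xbar θ) x y xt yt z →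
        ∀ᶠ i in atTop,
          (x (i + 1) = z i ∨ y (i + 1) = z i) ∧
          (x i ≠ y i → MountainPass.IncreasesThenDecreases
            (fun t => f (MountainPass.brokenLine (xt i) (z i) (yt i) t))) := by
  open MountainPass in
  obtain ⟨e, a, b, ε, θ₀, hH, hε, hεa, hεb, hεab, hθ₀, hdiff₀, happ₀⟩ :=
    exists_isSaddleForm_approx hf hcrit hmorse
  refine ⟨θ₀, hθ₀, fun θ _ hθ x y xt yt z _ _ _ _ _ hrun => Eventually.of_forall fun i => ?_⟩
  have hsub : Metric.ball xbar θ ⊆ Metric.ball xbar θ₀ := Metric.ball_subset_ball hθ.le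
  have hdiff := fun p hp => hdiff₀ p (hsub hp)
  have happ := fun p hp q hq => happ₀ p (hsub hp) q (hsub hq)
  have hUo : IsOpen (Metric.ball xbar θ) := Metric.isOpen_ball
  have hUc : Convex ℝ (Metric.ball xbar θ) := convex_ball xbar θ
  by_cases hxy : x i = y i
  · obtain ⟨-, -, h1, h2, -⟩ := hrun.stopped i hxy
    exact ⟨Or.inl (h2.trans h1.symm), fun h => absurd hxy h⟩
  obtain ⟨hjx, hjy, hmin⟩ := hrun.closest i hxy
  obtain ⟨hzmem, hzmin⟩ := hrun.bisector i hxy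
  have hpU := hjx.target_mem.2
  have hrU := hjy.target_mem.2
  -- If the two points coincided, the bisector would be the whole space and `z i` would minimize `f`
  -- on the ball.
  have hpr : yt i - xt i ≠ 0 := by
    intro h0
    have h1 : xt i = yt i := (sub_eq_zero.1 h0).symm
    rw [h1, AffineSubspace.perpBisector_self, AffineSubspace.top_coe, univ_inter] at hzmin
    exact hH.not_isMinOn (by linarith) hUc hUo hdiff happ hzmem.2 hzmin
  obtain ⟨hp, hp₀, hp₁⟩ := isClosest_first_order hUo (hdiff _ hpU) hjx
    (fun u hu => hmin u (yt i) hu hjy) hpr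
  obtain ⟨hr, hr₀, hr₁⟩ := isClosest_first_order hUo (hdiff _ hrU) hjy
    (fun v hv => by rw [dist_comm, dist_comm v]; exact hmin (xt i) v hjx hv)
    (by rw [← neg_sub]; exact neg_ne_zero.2 hpr)
  rw [← neg_sub, map_neg] at hr₁
  obtain ⟨s₁, hs₁, s₂, hs₂, hm₁, ha₁, hm₂, ha₂, h⟩ := hH.exists_unimodal_of_critical hε hεa hεb hεab
    hUc hdiff happ hpU hrU hzmem.2 hpr (hp.trans hr.symm) hp₀ hp₁
    (fun v hv => hr₀ v (by rw [← neg_sub, inner_neg_left, hv, neg_zero])) (by linarith)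
    (fun v hv => fderiv_eq_zero_of_isMinOn_perpBisector hUo (hdiff _ hzmem.2) hzmem hzmin hv)
    hzmem.1
  refine ⟨?_, fun _ => increasesThenDecreases_brokenLine hs₁ hs₂ hm₁ ha₁ hm₂ ha₂ h⟩
  rcases h with ⟨rfl, -⟩ | ⟨rfl, -⟩
  · exact Or.inl ((hrun.next_x i hxy).eq_of_strictMonoOn hm₁)
  -- Step 2 runs from `yt i` to `z i`, so the decrease on `[z i, yt i]` is read backwards through `t
  -- ↦ 1 - t`.
  · refine Or.inr ((hrun.next_y i hxy).eq_of_strictMonoOn ?_)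
    rintro t ⟨ht0, ht1⟩ t' ⟨ht0', ht1'⟩ htt'
    have h1 := ha₂ (a := 1 - t') ⟨by linarith, by linarith⟩ (b := 1 - t)
      ⟨by linarith, by linarith⟩ (by linarith)
    simpa only [AffineMap.lineMap_apply_one_sub] using h1
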